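/- A non-compact locally compact Cantor space is a non-compact locally compact metrizable space with no isolated points and with a countable basis of compact open sets. A Borel measure is called full if every non-empty open set has positive measure. For a Borel measure $\mu$ on a topological space $X$, put $$S(\mu) = \{\mu(U) : U \subseteq X \text{ compact open},\ \mu(U) < \infty\},$$ and call $\mu$ good if for all compact open sets $U, V \subseteq X$ with $\mu(U) < \mu(V)$ there is a compact open set $W \subseteq V$ with $\mu(W) = \mu(U)$. Theorem 3.7. Let $X$, $Y$ be non-compact locally compact Cantor spaces, and let $\mu$, $\nu$ be full non-atomic Borel probability measures on $X$ and $Y$, respectively, which are good. Let $\omega X$, $\omega Y$ be the one-point (Alexandroff) compactifications of $X$, $Y$, and extend $\mu$, $\nu$ to Borel measures on $\omega X$, $\omega Y$ by giving measure zero to the point at infinity. Suppose that both extensions are good. Then the following are equivalent: 1. $\mu$ and $\nu$ are homeomorphic, that is, there is a homeomorphism $h \colon X \to Y$ with $\mu(E) = \nu(h(E))$ for every Borel set $E \subseteq X$; 2. $S(\mu) = S(\nu)$. -/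

import Mathlib

open MeasureTheory TopologicalSpace

universe u v

/-- A non-compact locally compact Cantor space: a non-compact locally compact metrizable space
without isolated points which has a countable basis of compact open sets. -/
structure IsNoncompactCantorSpace (X : Type u) [TopologicalSpace X] : Prop where
  noncompact : NoncompactSpace X
  locallyCompact : LocallyCompactSpace X
  metrizable : MetrizableSpace X
  noIsolated : ∀ x : X, ¬ IsOpen ({x} : Set X)
  basis : ∃ B : Set (Set X),
    B.Countable ∧ IsTopologicalBasis B ∧ ∀ U ∈ B, IsCompact U ∧ IsOpen U

/-- The class of measures under study, for total mass one: full (every non-empty open set has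
positive measure) non-atomic Borel probability measures. The σ-algebra is required to be the Borel
one by the `BorelSpace` binder in the theorem. -/
structure IsFullNonatomicProbability {X : Type u} [TopologicalSpace X] [MeasurableSpace X]
    (μ : Measure X) : Prop where
  probability : IsProbabilityMeasure μ
  full : ∀ U : Set X, IsOpen U → U.Nonempty → 0 < μ U
  nonatomic : ∀ x : X, μ {x} = 0

/-- The compact open values set `S(μ)`: all finite values of `μ` on compact open sets. -/
def compactOpenValues {X : Type u} [TopologicalSpace X] [MeasurableSpace X]
    (μ : Measure X) : Set ℝ :=
  {r | ∃ U : Set X, IsCompact U ∧ IsOpen U ∧ μ U < ⊤ ∧ r = (μ U).toReal}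

/-- A compact open set `V` is good for `μ` if every compact open `U` with `μ U < μ V` has the same
measure as some compact open subset of `V`. -/
def IsGoodSet {X : Type u} [TopologicalSpace X] [MeasurableSpace X]
    (μ : Measure X) (V : Set X) : Prop :=
  ∀ U : Set X, IsCompact U → IsOpen U → μ U < μ V →
    ∃ W : Set X, IsCompact W ∧ IsOpen W ∧ W ⊆ V ∧ μ W = μ U

/-- A measure is good if every compact open set is good for it. -/
def IsGoodMeasure {X : Type u} [TopologicalSpace X] [MeasurableSpace X]
    (μ : Measure X) : Prop :=
  ∀ V : Set X, IsCompact V → IsOpen V → IsGoodSet μ V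

/-- Two measures are homeomorphic if some homeomorphism of the spaces carries one to the other. -/
def AreHomeomorphicMeasures {X : Type u} {Y : Type v} [TopologicalSpace X] [MeasurableSpace X]
    [TopologicalSpace Y] [MeasurableSpace Y] (μ : Measure X) (ν : Measure Y) : Prop :=
  ∃ h : X ≃ₜ Y, ∀ E : Set X, MeasurableSet E → μ E = ν (h '' E)

/-- The one-point compactification carries its Borel σ-algebra. -/
instance onePointMeasurableSpace (X : Type u) [TopologicalSpace X] :
    MeasurableSpace (OnePoint X) := borel (OnePoint X)

instance onePointBorelSpace (X : Type u) [TopologicalSpace X] : BorelSpace (OnePoint X) := ⟨rfl⟩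

/-- The extension of a Borel measure on `X` to the one-point compactification that gives measure
zero to the point at infinity: the image of `μ` under the inclusion. -/
noncomputable def onePointExtension {X : Type u} [TopologicalSpace X] [MeasurableSpace X]
    (μ : Measure X) : Measure (OnePoint X) :=
  Measure.map ((↑) : X → OnePoint X) μ

/-- The extension restricts to `μ` on `X`. -/
theorem onePointExtension_image {X : Type u} [TopologicalSpace X] [MeasurableSpace X]
    [BorelSpace X] (μ : Measure X) (E : Set X) :
    onePointExtension μ (((↑) : X → OnePoint X) '' E) = μ E := by
  have h : MeasurableEmbedding ((↑) : X → OnePoint X) :=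
    OnePoint.isOpenEmbedding_coe.measurableEmbedding
  rw [onePointExtension, h.map_apply, Set.preimage_image_eq _ OnePoint.coe_injective]

/-- The extension gives measure zero to the point at infinity. -/
theorem onePointExtension_infty {X : Type u} [TopologicalSpace X] [MeasurableSpace X]
    [BorelSpace X] (μ : Measure X) :
    onePointExtension μ {OnePoint.infty} = 0 := by
  have h : MeasurableEmbedding ((↑) : X → OnePoint X) :=
    OnePoint.isOpenEmbedding_coe.measurableEmbedding
  rw [onePointExtension, h.map_apply, OnePoint.coe_preimage_infty, measure_empty]

open Set

/-! A homeomorphism carries compact open sets to compact open sets, so the value set is an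
invariant. The converse is a back-and-forth over the countably many compact open sets of both
spaces. A finite family of pairs is kept such that corresponding cells (atoms of the generated
Boolean algebras) have equal measure. `exists_compactOpens_forall_cell` adds a new set: its trace on
each cell is copied, by goodness, into the matching cell.

In the limit every compact open set on either side has partners. Since the measures are full, finite
cells on the two sides are nonempty together, and compactness turns this into a bijection of points,
which is a homeomorphism. It preserves the measure of compact open sets, hence of all Borel sets. -/

theorem IsNoncompactCantorSpace.t2Space {X : Type u} [TopologicalSpace X]
    (hX : IsNoncompactCantorSpace X) : T2Space X :=
  haveI := hX.metrizable
  inferInstance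

theorem IsNoncompactCantorSpace.isTopologicalBasis_compactOpens {X : Type u} [TopologicalSpace X]
    (hX : IsNoncompactCantorSpace X) :
    IsTopologicalBasis (range ((↑) : CompactOpens X → Set X)) := by
  obtain ⟨B, -, hB, hBK⟩ := hX.basis
  refine hB.of_isOpen_of_subset ?_ fun U hU ↦ ⟨⟨⟨U, (hBK U hU).1⟩, (hBK U hU).2⟩, rfl⟩
  rintro _ ⟨U, rfl⟩
  exact U.isOpen

/-- A compact open set is a finite union of members of the countable basis. -/
theorem IsNoncompactCantorSpace.countable_compactOpens {X : Type u} [TopologicalSpace X]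
    (hX : IsNoncompactCantorSpace X) : Countable (CompactOpens X) := by
  obtain ⟨B, hBc, hB, -⟩ := hX.basis
  have hfin : {s : Set (Set X) | s.Finite ∧ s ⊆ B}.Countable := countable_ofPred_finite_subset hBc
  have hsub : range ((↑) : CompactOpens X → Set X) ⊆
      sUnion '' {s : Set (Set X) | s.Finite ∧ s ⊆ B} := by
    rintro _ ⟨U, rfl⟩
    obtain ⟨S, hSB, hSU⟩ := hB.open_eq_sUnion U.isOpen
    obtain ⟨T, hTS, hT, hUT⟩ := U.isCompact.elim_finite_subcover_image (c := id)
      (fun s hs ↦ hB.isOpen (hSB hs)) (hSU.trans sUnion_eq_biUnion).subset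
    refine ⟨T, ⟨hT, hTS.trans hSB⟩, Subset.antisymm ?_ (hUT.trans sUnion_eq_biUnion.superset)⟩
    rw [hSU]
    exact sUnion_subset_sUnion hTS
  have := ((hfin.image sUnion).mono hsub).to_subtype
  exact Function.Injective.countable (rangeFactorization_injective.2 SetLike.coe_injective)

/-- A measure of an open set is approximated from inside by compact open sets. -/
theorem IsNoncompactCantorSpace.exists_compactOpens_subset_lt {X : Type u} [TopologicalSpace X]
    [MeasurableSpace X] (hX : IsNoncompactCantorSpace X) (μ : Measure X) {G : Set X}
    (hG : IsOpen G) {r : ENNReal} (hr : r < μ G) :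
    ∃ V : CompactOpens X, (V : Set X) ⊆ G ∧ r < μ V := by
  have := hX.countable_compactOpens
  have hGU : G = ⋃ V ∈ {V : CompactOpens X | (V : Set X) ⊆ G}, (V : Set X) := by
    refine Subset.antisymm (fun x hx ↦ ?_) (iUnion₂_subset fun V hV ↦ hV)
    obtain ⟨_, ⟨V, rfl⟩, hxV, hVG⟩ :=
      hX.isTopologicalBasis_compactOpens.exists_subset_of_mem_open hx hG
    exact mem_biUnion (show V ∈ {V : CompactOpens X | (V : Set X) ⊆ G} from hVG) hxV
  rw [hGU, measure_biUnion_eq_iSup (to_countable _)] at hr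
  · simp only [lt_iSup_iff] at hr
    obtain ⟨V, hV, h⟩ := hr
    exact ⟨V, hV, h⟩
  · intro V hV W hW
    exact ⟨V ⊔ W, union_subset hV hW, subset_union_left, subset_union_right⟩

/-- The set of points whose membership in the sets `f i`, `i ∈ F`, is prescribed by `S`. -/
def cell {ι α : Type*} (f : ι → Set α) (F S : Finset ι) : Set α :=
  {x | ∀ i ∈ F, x ∈ f i ↔ i ∈ S}

/-! ### Cells of a finite family of sets -/

section Cell

variable {ι α : Type*} (f : ι → Set α)

theorem cell_empty (S : Finset ι) : cell f ∅ S = univ := by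
  simp [cell]

theorem cell_inter_right [DecidableEq ι] (F S : Finset ι) : cell f F (F ∩ S) = cell f F S := by
  ext x
  simp +contextual [cell]

theorem cell_insert_of_mem [DecidableEq ι] (F : Finset ι) {S : Finset ι} {i : ι} (hi : i ∈ S) :
    cell f (insert i F) S = f i ∩ cell f F S := by
  ext x
  simp [cell, hi]

theorem cell_insert_of_notMem [DecidableEq ι] (F : Finset ι) {S : Finset ι} {i : ι} (hi : i ∉ S) :
    cell f (insert i F) S = cell f F S \ f i := by
  ext x
  simp [cell, hi, and_comm]

theorem inter_cell_of_mem {F S : Finset ι} {i : ι} (hi : i ∈ F) (hS : i ∈ S) :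
    f i ∩ cell f F S = cell f F S :=
  inter_eq_right.2 fun _ hx ↦ (hx i hi).2 hS

theorem inter_cell_of_notMem {F S : Finset ι} {i : ι} (hi : i ∈ F) (hS : i ∉ S) :
    f i ∩ cell f F S = ∅ := by
  ext x
  simpa using fun hx h ↦ hS ((h i hi).1 hx)

theorem eq_of_mem_cell {F S T : Finset ι} (hS : S ⊆ F) (hT : T ⊆ F) {x : α}
    (hxS : x ∈ cell f F S) (hxT : x ∈ cell f F T) : S = T := by
  ext i
  exact ⟨fun hi ↦ (hxT i (hS hi)).1 ((hxS i (hS hi)).2 hi),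
    fun hi ↦ (hxS i (hT hi)).1 ((hxT i (hT hi)).2 hi)⟩

theorem exists_mem_cell (F : Finset ι) (x : α) : ∃ S ⊆ F, x ∈ cell f F S := by
  classical
  exact ⟨F.filter (x ∈ f ·), F.filter_subset _, fun i hi ↦ by simp [hi]⟩

theorem isClopen_cell [TopologicalSpace α] {f : ι → Set α} (hf : ∀ i, IsClopen (f i))
    (F S : Finset ι) : IsClopen (cell f F S) := by
  classical
  induction F using Finset.induction_on with
  | empty => simpa [cell_empty] using isClopen_univ
  | insert i F _ ih =>
    by_cases hi : i ∈ S
    · rw [cell_insert_of_mem f F hi]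
      exact (hf i).inter ih
    · rw [cell_insert_of_notMem f F hi]
      exact ih.diff (hf i)

theorem measure_eq_sum_inter_cell [TopologicalSpace α] [MeasurableSpace α] [BorelSpace α]
    {f : ι → Set α} (hf : ∀ i, IsClopen (f i)) (μ : Measure α) (F : Finset ι) {A : Set α}
    (hA : MeasurableSet A) : μ A = ∑ S ∈ F.powerset, μ (A ∩ cell f F S) := by
  rw [← measure_biUnion_finset]
  · congr 1
    ext x
    obtain ⟨S, hS, hx⟩ := exists_mem_cell f F x
    simp only [mem_iUnion, mem_inter_iff, Finset.mem_powerset]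
    exact ⟨fun h ↦ ⟨S, hS, h, hx⟩, fun ⟨_, _, h, _⟩ ↦ h⟩
  · intro S hS T hT hST
    refine disjoint_left.2 fun x hxS hxT ↦ hST ?_
    exact eq_of_mem_cell f (by simpa using hS) (by simpa using hT) hxS.2 hxT.2
  · exact fun S _ ↦ hA.inter (isClopen_cell hf F S).2.measurableSet

theorem isCompact_cell [TopologicalSpace α] {f : ι → Set α} (hf : ∀ i, IsClopen (f i))
    {F S : Finset ι} {i : ι} (hi : i ∈ F) (hS : i ∈ S) (hfi : IsCompact (f i)) :
    IsCompact (cell f F S) :=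
  hfi.of_isClosed_subset (isClopen_cell hf F S).1 fun _ hx ↦ (hx i hi).2 hS

/-- The cell outside every `f i` has a relatively compact complement, so its compactness would make
the whole space compact. -/
theorem exists_mem_of_isCompact_cell [TopologicalSpace α] [NoncompactSpace α] {f : ι → Set α}
    (hf : ∀ i, IsCompact (f i)) {F S : Finset ι} (hc : IsCompact (cell f F S)) :
    ∃ i ∈ F, i ∈ S := by
  by_contra! h
  refine noncompact_univ α (((F.isCompact_biUnion fun i _ ↦ hf i).union hc).of_isClosed_subset
    isClosed_univ fun x _ ↦ ?_)
  by_cases hx : ∃ i ∈ F, x ∈ f i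
  · exact Or.inl (by simpa using hx)
  · push Not at hx
    exact Or.inr fun i hi ↦ iff_of_false (hx i hi) (h i hi)

end Cell

/-! ### Copying a compact open set to the other space -/

/-- Goodness compares sets within one space, so `A` is first replaced by a compact open set of `Y`
with the same measure; that set is then fitted into a compact open `V ⊆ G` that is still larger in
measure. -/
theorem exists_compactOpens_subset_measure_eq {X : Type u} {Y : Type v}
    [TopologicalSpace X] [MeasurableSpace X] [TopologicalSpace Y] [MeasurableSpace Y]
    (hY : IsNoncompactCantorSpace Y) {μ : Measure X} {ν : Measure Y} [IsFiniteMeasure μ]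
    [IsFiniteMeasure ν] (hν : IsGoodMeasure ν)
    (hS : compactOpenValues μ ⊆ compactOpenValues ν) (A : CompactOpens X) {G : Set Y}
    (hG : IsOpen G) (hlt : μ A < ν G) : ∃ W : CompactOpens Y, (W : Set Y) ⊆ G ∧ ν W = μ A := by
  obtain ⟨V, hVG, hV⟩ := hY.exists_compactOpens_subset_lt ν hG hlt
  obtain ⟨U, hUc, hUo, -, hU⟩ := hS ⟨A, A.isCompact, A.isOpen, measure_lt_top μ _, rfl⟩
  rw [ENNReal.toReal_eq_toReal_iff' (measure_ne_top μ _) (measure_ne_top ν _)] at hU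
  obtain ⟨W, hWc, hWo, hWV, hW⟩ := hν V V.isCompact V.isOpen U hUc hUo (hU ▸ hV)
  exact ⟨⟨⟨W, hWc⟩, hWo⟩, hWV.trans hVG, hW.trans hU.symm⟩

/-- One step of the back-and-forth construction: a compact open set on one side has a counterpart
on the other side which meets all cells in sets of the same measure. -/
theorem exists_compactOpens_forall_cell {X : Type u} {Y : Type v} {ι : Type*}
    [TopologicalSpace X] [MeasurableSpace X] [BorelSpace X]
    [TopologicalSpace Y] [MeasurableSpace Y] [BorelSpace Y]
    (hX : IsNoncompactCantorSpace X) (hY : IsNoncompactCantorSpace Y)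
    {μ : Measure X} {ν : Measure Y}
    (hμ : IsFullNonatomicProbability μ) (hν : IsFullNonatomicProbability ν)
    (hνgood : IsGoodMeasure ν) (hS : compactOpenValues μ ⊆ compactOpenValues ν)
    (f : ι → CompactOpens X) (g : ι → CompactOpens Y) (F : Finset ι)
    (hF : ∀ S, μ (cell (fun i ↦ (f i : Set X)) F S) = ν (cell (fun i ↦ (g i : Set Y)) F S))
    (U : CompactOpens X) :
    ∃ V : CompactOpens Y, ∀ S,
      μ (U ∩ cell (fun i ↦ (f i : Set X)) F S) = ν (V ∩ cell (fun i ↦ (g i : Set Y)) F S) ∧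
      μ (cell (fun i ↦ (f i : Set X)) F S \ U) = ν (cell (fun i ↦ (g i : Set Y)) F S \ V) := by
  classical
  have := hX.t2Space
  have := hY.t2Space
  have := hX.noncompact
  have := hμ.probability
  have := hν.probability
  set f' : ι → Set X := fun i ↦ f i
  set g' : ι → Set Y := fun i ↦ g i
  have hf : ∀ i, IsClopen (f' i) := fun i ↦ ⟨(f i).isCompact.isClosed, (f i).isOpen⟩
  have hg : ∀ i, IsClopen (g' i) := fun i ↦ ⟨(g i).isCompact.isClosed, (g i).isOpen⟩
  have hcell : ∀ S, ∃ W : CompactOpens Y, (W : Set Y) ⊆ cell g' F S ∧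
      ν W = μ (U ∩ cell f' F S) := by
    intro S
    have hC := isClopen_cell hf F S
    have hD := isClopen_cell hg F S
    obtain hlt | hle := lt_or_ge (μ (U ∩ cell f' F S)) (ν (cell g' F S))
    · exact exists_compactOpens_subset_measure_eq hY hνgood hS
        ⟨⟨U ∩ cell f' F S, U.isCompact.inter_right hC.1⟩, U.isOpen.inter hC.2⟩ hD.2 hlt
    -- Goodness needs a strict inequality. Otherwise `U` fills the cell up to an open null set,
    -- which is empty by fullness. The cell is then compact, so it lies in some `f i`; its
    -- counterpart lies in `g i`, is compact too, and can be taken whole.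
    · rw [← hF S] at hle
      have hdiff : cell f' F S \ U = ∅ := by
        by_contra hne
        refine (hμ.full _ (hC.2.sdiff U.isCompact.isClosed) (nonempty_iff_ne_empty.2 hne)).ne' ?_
        have h := measure_inter_add_sdiff (μ := μ) (cell f' F S) U.isOpen.measurableSet
        rw [inter_comm] at h
        have h' : μ (U ∩ cell f' F S) + μ (cell f' F S \ U) ≤ μ (U ∩ cell f' F S) + 0 := by
          rw [h, add_zero]
          exact hle
        exact le_zero_iff.1 ((ENNReal.add_le_add_iff_left (measure_ne_top μ _)).1 h')
      have hsub : cell f' F S ⊆ U := sdiff_eq_empty.1 hdiff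
      obtain ⟨i, hiF, hiS⟩ := exists_mem_of_isCompact_cell (fun i ↦ (f i).isCompact)
        (U.isCompact.of_isClosed_subset hC.1 hsub)
      refine ⟨⟨⟨cell g' F S, isCompact_cell hg hiF hiS (g i).isCompact⟩, hD.2⟩, Subset.rfl, ?_⟩
      rw [inter_eq_right.2 hsub, hF S]
      rfl
  choose W hWsub hW using hcell
  refine ⟨F.powerset.sup W, fun S ↦ ?_⟩
  have hcoe : ((F.powerset.sup W : CompactOpens Y) : Set Y) = ⋃ T ∈ F.powerset, (W T : Set Y) := by
    induction F.powerset using Finset.induction_on with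
    | empty => simp
    | insert T P _ ih => simp [ih]
  -- Cells for distinct subsets of `F` are disjoint, so only one piece of the union survives. Its
  -- index is `F ∩ S`, as `S` need not lie in `F`.
  have hinter : ((F.powerset.sup W : CompactOpens Y) : Set Y) ∩ cell g' F S = W (F ∩ S) := by
    rw [hcoe, ← cell_inter_right]
    ext y
    simp only [mem_inter_iff, mem_iUnion, Finset.mem_powerset, SetLike.mem_coe]
    refine ⟨?_, fun hy ↦ ⟨⟨F ∩ S, Finset.inter_subset_left, hy⟩, hWsub _ hy⟩⟩
    rintro ⟨⟨T, hT, hyT⟩, hy⟩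
    rwa [eq_of_mem_cell g' Finset.inter_subset_left hT hy (hWsub _ hyT)]
  have h1 : μ (U ∩ cell f' F S) =
      ν (((F.powerset.sup W : CompactOpens Y) : Set Y) ∩ cell g' F S) := by
    rw [hinter, hW, cell_inter_right]
  refine ⟨h1, ?_⟩
  have hμadd := measure_inter_add_sdiff (μ := μ) (cell f' F S) U.isOpen.measurableSet
  have hνadd := measure_inter_add_sdiff (μ := ν) (cell g' F S)
    (F.powerset.sup W).isOpen.measurableSet
  rw [inter_comm] at hμadd hνadd
  rw [hF S, ← hνadd, h1] at hμadd
  exact (ENNReal.add_right_inj (measure_ne_top ν _)).1 hμadd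

/-! ### Balanced families and back-and-forth -/

/-- A finite set of pairs of compact open sets is balanced if the cells cut out by the first
components have the same measures as the corresponding cells cut out by the second components. -/
def IsBalanced {X : Type u} {Y : Type v} [TopologicalSpace X] [MeasurableSpace X]
    [TopologicalSpace Y] [MeasurableSpace Y] (μ : Measure X) (ν : Measure Y)
    (F : Finset (CompactOpens X × CompactOpens Y)) : Prop :=
  ∀ S, μ (cell (fun p ↦ (p.1 : Set X)) F S) = ν (cell (fun p ↦ (p.2 : Set Y)) F S)

theorem IsBalanced.insert {X : Type u} {Y : Type v} [TopologicalSpace X] [MeasurableSpace X]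
    [TopologicalSpace Y] [MeasurableSpace Y] {μ : Measure X} {ν : Measure Y}
    [DecidableEq (CompactOpens X × CompactOpens Y)]
    {F : Finset (CompactOpens X × CompactOpens Y)} {U : CompactOpens X} {V : CompactOpens Y}
    (h : ∀ S,
      μ (U ∩ cell (fun p ↦ (p.1 : Set X)) F S) = ν (V ∩ cell (fun p ↦ (p.2 : Set Y)) F S) ∧
      μ (cell (fun p ↦ (p.1 : Set X)) F S \ U) = ν (cell (fun p ↦ (p.2 : Set Y)) F S \ V)) :
    IsBalanced μ ν (insert (U, V) F) := by
  intro S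
  by_cases hS : (U, V) ∈ S
  · simpa only [cell_insert_of_mem _ F hS] using (h S).1
  · simpa only [cell_insert_of_notMem _ F hS] using (h S).2

theorem IsBalanced.measure_eq {X : Type u} {Y : Type v}
    [TopologicalSpace X] [T2Space X] [MeasurableSpace X] [BorelSpace X]
    [TopologicalSpace Y] [T2Space Y] [MeasurableSpace Y] [BorelSpace Y]
    {μ : Measure X} {ν : Measure Y} {F : Finset (CompactOpens X × CompactOpens Y)}
    (hF : IsBalanced μ ν F) {p : CompactOpens X × CompactOpens Y} (hp : p ∈ F) :
    μ p.1 = ν p.2 := by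
  rw [measure_eq_sum_inter_cell (f := fun p : CompactOpens X × CompactOpens Y ↦ (p.1 : Set X))
      (fun p ↦ ⟨p.1.isCompact.isClosed, p.1.isOpen⟩) μ F p.1.isOpen.measurableSet,
    measure_eq_sum_inter_cell (f := fun p : CompactOpens X × CompactOpens Y ↦ (p.2 : Set Y))
      (fun p ↦ ⟨p.2.isCompact.isClosed, p.2.isOpen⟩) ν F p.2.isOpen.measurableSet]
  refine Finset.sum_congr rfl fun S _ ↦ ?_
  by_cases hS : p ∈ S
  · rw [inter_cell_of_mem (fun p : CompactOpens X × CompactOpens Y ↦ (p.1 : Set X)) hp hS,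
      inter_cell_of_mem (fun p : CompactOpens X × CompactOpens Y ↦ (p.2 : Set Y)) hp hS]
    exact hF S
  · rw [inter_cell_of_notMem (fun p : CompactOpens X × CompactOpens Y ↦ (p.1 : Set X)) hp hS,
      inter_cell_of_notMem (fun p : CompactOpens X × CompactOpens Y ↦ (p.2 : Set Y)) hp hS]
    simp

/-- The back-and-forth construction. -/
theorem exists_balanced_correspondence {X : Type u} {Y : Type v}
    [TopologicalSpace X] [MeasurableSpace X] [BorelSpace X]
    [TopologicalSpace Y] [MeasurableSpace Y] [BorelSpace Y]
    (hX : IsNoncompactCantorSpace X) (hY : IsNoncompactCantorSpace Y)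
    {μ : Measure X} {ν : Measure Y}
    (hμ : IsFullNonatomicProbability μ) (hν : IsFullNonatomicProbability ν)
    (hμgood : IsGoodMeasure μ) (hνgood : IsGoodMeasure ν)
    (hS : compactOpenValues μ = compactOpenValues ν) :
    ∃ R : Set (CompactOpens X × CompactOpens Y),
      (∀ U, ∃ V, (U, V) ∈ R) ∧ (∀ V, ∃ U, (U, V) ∈ R) ∧
      ∀ T : Finset (CompactOpens X × CompactOpens Y), ↑T ⊆ R → ∃ F, T ⊆ F ∧ IsBalanced μ ν F := by
  classical
  have := hX.countable_compactOpens
  have := hY.countable_compactOpens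
  have := hμ.probability
  have := hν.probability
  let := Encodable.ofCountable (CompactOpens X ⊕ CompactOpens Y)
  let P := {F : Finset (CompactOpens X × CompactOpens Y) // IsBalanced μ ν F}
  -- One cofinal set per compact open set of either space: the left summand is "forth", the right
  -- one "back".
  let D : CompactOpens X ⊕ CompactOpens Y → Order.Cofinal P := Sum.elim
    (fun U ↦
      { carrier := {F | ∃ V, (U, V) ∈ F.1}
        isCofinal := fun F ↦ by
          obtain ⟨V, hV⟩ := exists_compactOpens_forall_cell hX hY hμ hν hνgood hS.subset
            Prod.fst Prod.snd F.1 F.2 U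
          exact ⟨⟨insert (U, V) F.1, IsBalanced.insert hV⟩, ⟨V, Finset.mem_insert_self _ _⟩,
            Finset.subset_insert _ _⟩ })
    (fun V ↦
      { carrier := {F | ∃ U, (U, V) ∈ F.1}
        isCofinal := fun F ↦ by
          obtain ⟨U, hU⟩ := exists_compactOpens_forall_cell hY hX hν hμ hμgood hS.superset
            Prod.snd Prod.fst F.1 (fun S ↦ (F.2 S).symm) V
          exact ⟨⟨insert (U, V) F.1,
              IsBalanced.insert fun S ↦ ⟨(hU S).1.symm, (hU S).2.symm⟩⟩,
            ⟨U, Finset.mem_insert_self _ _⟩, Finset.subset_insert _ _⟩ })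
  -- The empty family has the whole space as its only cell, of measure 1 on both sides.
  let I : Order.Ideal P := Order.idealOfCofinals ⟨∅, fun S ↦ by simp [cell_empty]⟩ D
  refine ⟨{p | ∃ F ∈ I, p ∈ F.1}, fun U ↦ ?_, fun V ↦ ?_, fun T hT ↦ ?_⟩
  · obtain ⟨F, ⟨V, hV⟩, hF⟩ := Order.cofinal_meets_idealOfCofinals _ D (Sum.inl U)
    exact ⟨V, F, hF, hV⟩
  · obtain ⟨F, ⟨U, hU⟩, hF⟩ := Order.cofinal_meets_idealOfCofinals _ D (Sum.inr V)
    exact ⟨U, F, hF, hU⟩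
  · suffices ∃ F ∈ I, T ⊆ F.1 by
      obtain ⟨F, -, hTF⟩ := this
      exact ⟨F.1, hTF, F.2⟩
    induction T using Finset.induction_on with
    | empty =>
      obtain ⟨F, hF⟩ := I.nonempty
      exact ⟨F, hF, Finset.empty_subset _⟩
    | insert p T _ ih =>
      rw [Finset.coe_insert, insert_subset_iff] at hT
      obtain ⟨F, hF, hpF⟩ := hT.1
      obtain ⟨F', hF', hTF'⟩ := ih hT.2
      obtain ⟨E, hE, hFE, hFE'⟩ := I.directed F hF F' hF'
      exact ⟨E, hE, Finset.insert_subset (hFE hpF) (hTF'.trans hFE')⟩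

/-! ### From compact open sets to points -/

/-- A correspondence between compact open sets that respects non-emptiness of finite cells
relates every point on one side to exactly one point on the other side. -/
theorem existsUnique_forall_mem_iff_mem {X : Type u} {Y : Type v} {ι : Type*}
    [TopologicalSpace X] [TopologicalSpace Y]
    (hX : IsNoncompactCantorSpace X) (hY : IsNoncompactCantorSpace Y)
    (f : ι → CompactOpens X) (g : ι → CompactOpens Y)
    (hf : Function.Surjective f) (hg : Function.Surjective g)
    (hfg : ∀ F S : Finset ι, (cell (fun i ↦ (f i : Set X)) F S).Nonempty →
      (cell (fun i ↦ (g i : Set Y)) F S).Nonempty) (x : X) :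
    ∃! y : Y, ∀ i, x ∈ f i ↔ y ∈ g i := by
  classical
  have := hY.t2Space
  refine existsUnique_of_exists_of_unique ?_ fun y z hy hz ↦ ?_
  · obtain ⟨_, ⟨U, rfl⟩, hxU, -⟩ :=
      hX.isTopologicalBasis_compactOpens.exists_subset_of_mem_open (mem_univ x) isOpen_univ
    obtain ⟨i₀, rfl⟩ := hf U
    have hclosed : ∀ i, IsClosed {y | x ∈ f i ↔ y ∈ g i} := fun i ↦ by
      by_cases hx : x ∈ f i
      · simpa [hx] using (g i).isCompact.isClosed
      · simp only [hx, false_iff]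
        exact (g i).isOpen.isClosed_compl
    -- `Y` is not compact, so the finite intersection property is used inside `g i₀`; adding `i₀` to
    -- each finite index set keeps the witnesses there.
    obtain ⟨y, -, hy⟩ := (g i₀).isCompact.inter_iInter_nonempty
      (fun i ↦ {y | x ∈ f i ↔ y ∈ g i}) hclosed fun F ↦ by
        obtain ⟨S, -, hS⟩ := exists_mem_cell (fun i ↦ (f i : Set X)) (insert i₀ F) x
        obtain ⟨y, hy⟩ := hfg _ S ⟨x, hS⟩
        have hiff : ∀ i ∈ insert i₀ F, x ∈ f i ↔ y ∈ g i :=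
          fun i hi ↦ (hS i hi).trans (hy i hi).symm
        exact ⟨y, (hiff i₀ (Finset.mem_insert_self _ _)).1 hxU,
          mem_iInter₂.2 fun i hi ↦ hiff i (Finset.mem_insert_of_mem hi)⟩
    exact ⟨y, mem_iInter.1 hy⟩
  · by_contra hne
    obtain ⟨_, ⟨V, rfl⟩, hyV, hV⟩ := hY.isTopologicalBasis_compactOpens.exists_subset_of_mem_open
      (show y ∈ ({z}ᶜ : Set Y) from hne) isOpen_compl_singleton
    obtain ⟨i, rfl⟩ := hg V
    exact hV ((hz i).1 ((hy i).2 hyV)) rfl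

theorem IsNoncompactCantorSpace.continuous_of_forall_mem_iff_mem {X : Type u} {Y : Type v}
    {ι : Type*} [TopologicalSpace X] [TopologicalSpace Y] (hY : IsNoncompactCantorSpace Y)
    {f : ι → CompactOpens X} {g : ι → CompactOpens Y} (hg : Function.Surjective g) {h : X → Y}
    (hh : ∀ x i, x ∈ f i ↔ h x ∈ g i) : Continuous h := by
  refine hY.isTopologicalBasis_compactOpens.continuous_iff.2 ?_
  rintro _ ⟨V, rfl⟩
  obtain ⟨i, rfl⟩ := hg V
  convert (f i).isOpen using 1
  ext x
  exact (hh x i).symm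

theorem exists_homeomorph_forall_mem_iff_mem {X : Type u} {Y : Type v} {ι : Type*}
    [TopologicalSpace X] [TopologicalSpace Y]
    (hX : IsNoncompactCantorSpace X) (hY : IsNoncompactCantorSpace Y)
    (f : ι → CompactOpens X) (g : ι → CompactOpens Y)
    (hf : Function.Surjective f) (hg : Function.Surjective g)
    (hfg : ∀ F S : Finset ι, (cell (fun i ↦ (f i : Set X)) F S).Nonempty ↔
      (cell (fun i ↦ (g i : Set Y)) F S).Nonempty) :
    ∃ h : X ≃ₜ Y, ∀ x i, x ∈ f i ↔ h x ∈ g i := by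
  choose h hh hh' using
    existsUnique_forall_mem_iff_mem hX hY f g hf hg fun F S ↦ (hfg F S).1
  choose k hk hk' using
    existsUnique_forall_mem_iff_mem hY hX g f hg hf fun F S ↦ (hfg F S).2
  dsimp only at hh hh' hk hk'
  exact ⟨{ toFun := h
           invFun := k
           left_inv := fun x ↦ (hk' (h x) x fun i ↦ (hh x i).symm).symm
           right_inv := fun y ↦ (hh' (k y) y fun i ↦ (hk y i).symm).symm
           continuous_toFun := hY.continuous_of_forall_mem_iff_mem hg hh
           continuous_invFun := hX.continuous_of_forall_mem_iff_mem hf hk }, hh⟩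

/-! ### Transport of measures and conclusion -/

theorem IsNoncompactCantorSpace.measure_ext {X : Type u} [TopologicalSpace X] [MeasurableSpace X]
    [BorelSpace X] (hX : IsNoncompactCantorSpace X) {μ ν : Measure X} [IsProbabilityMeasure μ]
    [IsProbabilityMeasure ν] (h : ∀ U : CompactOpens X, μ U = ν U) : μ = ν := by
  have := hX.t2Space
  have hc := hX.countable_compactOpens
  have hB := hX.isTopologicalBasis_compactOpens
  have : SecondCountableTopology X := hB.secondCountableTopology (countable_range _)
  refine ext_of_generate_finite (range ((↑) : CompactOpens X → Set X))
    ((BorelSpace.measurable_eq (α := X)).trans hB.borel_eq_generateFrom) ?_ ?_ (by simp)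
  · rintro _ ⟨U, rfl⟩ _ ⟨V, rfl⟩ -
    exact ⟨U ⊓ V, by simp⟩
  · rintro _ ⟨U, rfl⟩
    exact h U

theorem AreHomeomorphicMeasures.of_compactOpenValues_eq {X : Type u} {Y : Type v}
    [TopologicalSpace X] [MeasurableSpace X] [BorelSpace X]
    [TopologicalSpace Y] [MeasurableSpace Y] [BorelSpace Y]
    (hX : IsNoncompactCantorSpace X) (hY : IsNoncompactCantorSpace Y)
    {μ : Measure X} {ν : Measure Y}
    (hμ : IsFullNonatomicProbability μ) (hν : IsFullNonatomicProbability ν)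
    (hμgood : IsGoodMeasure μ) (hνgood : IsGoodMeasure ν)
    (hS : compactOpenValues μ = compactOpenValues ν) : AreHomeomorphicMeasures μ ν := by
  classical
  have := hX.t2Space
  have := hY.t2Space
  have := hμ.probability
  have := hν.probability
  obtain ⟨R, hR₁, hR₂, hR⟩ := exists_balanced_correspondence hX hY hμ hν hμgood hνgood hS
  have hf : ∀ p : CompactOpens X × CompactOpens Y, IsClopen (p.1 : Set X) :=
    fun p ↦ ⟨p.1.isCompact.isClosed, p.1.isOpen⟩
  have hg : ∀ p : CompactOpens X × CompactOpens Y, IsClopen (p.2 : Set Y) :=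
    fun p ↦ ⟨p.2.isCompact.isClosed, p.2.isOpen⟩
  have hcell : ∀ F S : Finset R, (cell (fun i ↦ (i.1.1 : Set X)) F S).Nonempty ↔
      (cell (fun i ↦ (i.1.2 : Set Y)) F S).Nonempty := by
    intro F S
    -- Balance is available only for a larger family `E`. Its cells refine those of `F`, are open,
    -- and so have positive measure when nonempty.
    obtain ⟨E, hE, hbal⟩ := hR (F.map (Function.Embedding.subtype _)) (by simp)
    have hmem : ∀ i ∈ F, i.1 ∈ E := fun i hi ↦ hE (by simpa using hi)
    constructor
    · rintro ⟨x, hx⟩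
      obtain ⟨T, -, hT⟩ :=
        exists_mem_cell (fun p : CompactOpens X × CompactOpens Y ↦ (p.1 : Set X)) E x
      have hpos := hμ.full _ (isClopen_cell hf E T).2 ⟨x, hT⟩
      rw [hbal T] at hpos
      obtain ⟨y, hy⟩ := nonempty_of_measure_ne_zero hpos.ne'
      exact ⟨y, fun i hi ↦ ((hy i.1 (hmem i hi)).trans (hT i.1 (hmem i hi)).symm).trans (hx i hi)⟩
    · rintro ⟨y, hy⟩
      obtain ⟨T, -, hT⟩ :=
        exists_mem_cell (fun p : CompactOpens X × CompactOpens Y ↦ (p.2 : Set Y)) E y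
      have hpos := hν.full _ (isClopen_cell hg E T).2 ⟨y, hT⟩
      rw [← hbal T] at hpos
      obtain ⟨x, hx⟩ := nonempty_of_measure_ne_zero hpos.ne'
      exact ⟨x, fun i hi ↦ ((hx i.1 (hmem i hi)).trans (hT i.1 (hmem i hi)).symm).trans (hy i hi)⟩
  obtain ⟨h, hh⟩ := exists_homeomorph_forall_mem_iff_mem hX hY (fun i : R ↦ i.1.1) (fun i ↦ i.1.2)
    (fun U ↦ let ⟨V, hV⟩ := hR₁ U; ⟨⟨_, hV⟩, rfl⟩) (fun V ↦ let ⟨U, hU⟩ := hR₂ V; ⟨⟨_, hU⟩, rfl⟩)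
    hcell
  have hmeas : Measurable h := h.continuous.measurable
  have : IsProbabilityMeasure (μ.map h) := Measure.isProbabilityMeasure_map hmeas.aemeasurable
  have hmap : μ.map h = ν := hY.measure_ext fun V ↦ by
    obtain ⟨U, hUV⟩ := hR₂ V
    obtain ⟨E, hE, hbal⟩ := hR {(U, V)} (by simpa using hUV)
    have hpre : h ⁻¹' V = U := ext fun x ↦ (hh x ⟨_, hUV⟩).symm
    rw [Measure.map_apply hmeas V.isOpen.measurableSet, hpre]
    exact hbal.measure_eq (hE (Finset.mem_singleton_self _))
  refine ⟨h, fun E hE ↦ ?_⟩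
  rw [← hmap, h.measurableEmbedding.map_apply, preimage_image_eq E h.injective]

theorem AreHomeomorphicMeasures.compactOpenValues_eq {X : Type u} {Y : Type v}
    [TopologicalSpace X] [MeasurableSpace X] [BorelSpace X]
    [TopologicalSpace Y] [MeasurableSpace Y]
    {μ : Measure X} {ν : Measure Y} (h : AreHomeomorphicMeasures μ ν) :
    compactOpenValues μ = compactOpenValues ν := by
  obtain ⟨h, hh⟩ := h
  ext r
  constructor
  · rintro ⟨U, hUc, hUo, hU, rfl⟩
    have hm := hh U hUo.measurableSet
    exact ⟨h '' U, hUc.image h.continuous, h.isOpenMap U hUo, hm ▸ hU, by rw [hm]⟩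
  · rintro ⟨V, hVc, hVo, hV, rfl⟩
    have hm := hh (h ⁻¹' V) (hVo.preimage h.continuous).measurableSet
    rw [image_preimage_eq V h.surjective] at hm
    exact ⟨h ⁻¹' V, h.isCompact_preimage.2 hVc, hVo.preimage h.continuous, hm ▸ hV, by rw [hm]⟩

theorem theorem3p7 {X : Type u} {Y : Type v}
    [TopologicalSpace X] [MeasurableSpace X] [BorelSpace X]
    [TopologicalSpace Y] [MeasurableSpace Y] [BorelSpace Y]
    (hX : IsNoncompactCantorSpace X) (hY : IsNoncompactCantorSpace Y)
    (μ : Measure X) (ν : Measure Y)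
    (hμ : IsFullNonatomicProbability μ) (hν : IsFullNonatomicProbability ν)
    (hμgood : IsGoodMeasure μ) (hνgood : IsGoodMeasure ν)
    (hμext : IsGoodMeasure (onePointExtension μ))
    (hνext : IsGoodMeasure (onePointExtension ν)) :
    AreHomeomorphicMeasures μ ν ↔ compactOpenValues μ = compactOpenValues ν := by
  exact ⟨fun h ↦ h.compactOpenValues_eq,
    AreHomeomorphicMeasures.of_compactOpenValues_eq hX hY hμ hν hμgood hνgood⟩
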